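/- A welfare rule is a function $w:\{1,2,\dots\}\to\mathbb{R}_{>0}$, extended by $w(0)=0$. It is submodular if $w(j+1)\ge w(j)$ for all $j\ge 0$ and $w(j+1)-w(j)$ is non-increasing in $j\ge 0$; a submodular welfare rule has curvature $c'\in[0,1]$ if $c'=1-\lim_{n\to\infty}(w(n+1)-w(n))/w(1)$. A resource allocation game $G$ consists of agents $1,\dots,n$, a finite set $R$ of resources, for each agent $i$ a finite set $A_i\subseteq 2^R$ of actions with $\varnothing\in A_i$, and for each resource $r$ a welfare rule $w_r$ and a utility rule $f_r:\{1,2,\dots\}\to\mathbb{R}_{\ge 0}$. For a joint action $a\in A=A_1\times\cdots\times A_n$ let $|a|_r$ be the number of agents $i$ with $r\in a_i$. The welfare of $a$ is $W(a)=\sum_{r\in\bigcup_i a_i}w_r(|a|_r)$ and the utility of agent $i$ is $U_i(a)=\sum_{r\in a_i}f_r(|a|_r)$. In a one-round best-response walk all agents start at the action $\varnothing$, and the agents $1,2,\dots,n$ then move once each, in this order; the moving agent switches to an arbitrary action that maximizes its utility given the current actions of the others. Let $\mathrm{sol}(1)\subseteq A$ be the set of joint actions in which such a walk can end, and for games with $\max_{a\in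 A}W(a)>0$ put $$\mathrm{Eff}(G;1)=\frac{\min_{a\in\mathrm{sol}(1)}W(a)}{\max_{a\in A}W(a)}.$$ For a set $\mathcal{W}$ of welfare rules and a utility design $F:\mathcal{W}\to\mathbb{R}_{\ge 0}^{\mathbb{N}}$ let $\mathcal{G}_{\mathcal{W},F}$ be the set of all such games (with any number of agents and resources) in which $w_r\in\mathcal{W}$ and $f_r=F(w_r)$ for every resource $r$, and let $$\mathrm{Eff}^*(\mathcal{W};1)=\sup_{F}\ \inf_{G\in\mathcal{G}_{\mathcal{W},F}}\mathrm{Eff}(G;1)$$ be the optimal efficiency guarantee achievable with a one-round best-response walk. **Theorem.** Let $c\in[0,1]$ and let $\mathcal{W}$ be the set of all submodular welfare rules of curvature at most $c$. Then $$\mathrm{Eff}^*(\mathcal{W};1)=1-\frac{c}{2}\ \Big(\ge\frac12\Big).$$ -/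

import Mathlib

open scoped NNReal

namespace ResourceAllocation

/-- A welfare rule is given by its values `w j > 0` at the numbers `j ≥ 1` of users of a resource;
an unused resource contributes nothing, `w 0 = 0`. -/
def IsWelfareRule (w : ℕ → ℝ) : Prop :=
  w 0 = 0 ∧ ∀ j, 1 ≤ j → 0 < w j

/-- Submodularity: `w` is nondecreasing and its increments are nonincreasing
(including the first increment `w 1 - w 0`). -/
def IsSubmodular (w : ℕ → ℝ) : Prop :=
  (∀ j, w j ≤ w (j + 1)) ∧ ∀ j, w (j + 2) - w (j + 1) ≤ w (j + 1) - w j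

/-- The submodular welfare rule `w` has curvature `c ∈ [0, 1]`, where
`c = 1 - lim (w (n + 1) - w n) / w 1`. -/
def HasCurvature (w : ℕ → ℝ) (c : ℝ) : Prop :=
  IsWelfareRule w ∧ IsSubmodular w ∧ c ∈ Set.Icc (0 : ℝ) 1 ∧
    Filter.Tendsto (fun n : ℕ => 1 - (w (n + 1) - w n) / w 1) Filter.atTop (nhds c)

/-- The set of all welfare rules of curvature at most `c`. -/
def curvatureClass (c : ℝ) : Set (ℕ → ℝ) :=
  {w | ∃ c' : ℝ, c' ≤ c ∧ HasCurvature w c'}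

/-- A resource allocation game with agents `0, …, n - 1` and resources `0, …, m - 1`. Each agent has
a finite set of actions, which are sets of resources and include the null action `∅`. Each
resource `r` carries a welfare rule `w r` and a nonnegative utility rule `f r`; only the values
`w r j` and `f r j` with `j ≥ 1` enter. -/
structure Game where
  n : ℕ
  m : ℕ
  act : Fin n → Finset (Finset (Fin m))
  null_mem : ∀ i, ∅ ∈ act i
  w : Fin m → ℕ → ℝ
  f : Fin m → ℕ → ℝ≥0

namespace Game

/-- An assignment of a set of resources to each agent. -/
abbrev Profile (G : Game) : Type := Fin G.n → Finset (Fin G.m)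

/-- The joint actions. -/
def jointActions (G : Game) : Set G.Profile :=
  {a | ∀ i, a i ∈ G.act i}

/-- The number of agents that select the resource `r` in `a`. -/
def load (G : Game) (a : G.Profile) (r : Fin G.m) : ℕ :=
  (Finset.univ.filter fun i => r ∈ a i).card

/-- The system welfare, a sum over the resources selected by at least one agent. -/
noncomputable def welfare (G : Game) (a : G.Profile) : ℝ :=
  ∑ r ∈ Finset.univ.biUnion a, G.w r (G.load a r)

/-- The utility of agent `i`. -/
noncomputable def utility (G : Game) (i : Fin G.n) (a : G.Profile) : ℝ :=
  ∑ r ∈ a i, (G.f r (G.load a r) : ℝ)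

/-- The best responses of agent `i` to the actions of the other agents in `a`. -/
def bestResponses (G : Game) (a : G.Profile) (i : Fin G.n) : Set (Finset (Fin G.m)) :=
  {b | b ∈ G.act i ∧ ∀ b' ∈ G.act i,
    G.utility i (Function.update a i b') ≤ G.utility i (Function.update a i b)}

/-- `a 0, …, a T` is a trajectory of the round-robin best response process that starts with the null
joint action: at step `τ` the agent `τ mod n` plays some best response and nobody else moves. -/
def IsTrajectory (G : Game) (T : ℕ) (a : ℕ → G.Profile) : Prop :=
  (a 0 = fun _ => ∅) ∧
    ∀ τ < T, ∃ i : Fin G.n, (i : ℕ) = τ % G.n ∧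
      a (τ + 1) i ∈ G.bestResponses (a τ) i ∧ ∀ j, j ≠ i → a (τ + 1) j = a τ j

/-- The joint actions in which a `k`-round walk (`k * n` steps) can end. -/
def solutions (G : Game) (k : ℕ) : Set G.Profile :=
  {b | ∃ a : ℕ → G.Profile, G.IsTrajectory (k * G.n) a ∧ a (k * G.n) = b}

/-- The worst welfare after a `k`-round walk divided by the best welfare. Both sets of profiles
are finite and nonempty, so that infimum and supremum are a minimum and a maximum. -/
noncomputable def efficiency (G : Game) (k : ℕ) : ℝ :=
  sInf (G.welfare '' G.solutions k) / sSup (G.welfare '' G.jointActions)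

end Game

/-- A utility design for a set of welfare rules assigns a utility rule to each of its elements. -/
abbrev UtilityDesign (W : Set (ℕ → ℝ)) : Type := W → ℕ → ℝ≥0

/-- The games induced by the set `W` of welfare rules and the utility design `F`. Games in which
every joint action has welfare zero, for which the efficiency ratio is `0 / 0`, are left out. -/
def inducedGames (W : Set (ℕ → ℝ)) (F : UtilityDesign W) : Set Game :=
  {G | (∀ r, ∃ h : G.w r ∈ W, G.f r = F ⟨G.w r, h⟩) ∧ ∃ a ∈ G.jointActions, 0 < G.welfare a}

/-- The efficiency guarantee of a set of games after a `k`-round walk. The infimum is taken in the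
extended reals. -/
noncomputable def setEfficiency (S : Set Game) (k : ℕ) : EReal :=
  ⨅ G ∈ S, ((G.efficiency k : ℝ) : EReal)

/-- The optimal efficiency guarantee after a `k`-round walk, over all utility designs. -/
noncomputable def optimalEfficiency (W : Set (ℕ → ℝ)) (k : ℕ) : EReal :=
  ⨆ F : UtilityDesign W, setEfficiency (inducedGames W F) k

end ResourceAllocation

/-! Lower bound. Write `d = (1 - c) * w 1`, a lower bound for all increments of `w`, and pay `f j =
(w j - w (j - 1) + d) / 2`. In a one-round walk an agent sees only its predecessors, so the
utilities received at the moments of moving add up, resource by resource, to `f 1 + ... + f x`,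
where `x` is the final load. Deviating to an alternative `o` would have paid at least `f (x + 1)`
per use, since `f` is nonincreasing. Hence the inequality `(1 - c / 2) * w y + (f 1 + ... + f x) ≤ w
x + y * f (x + 1)` for all loads `x`, `y` suffices (`smooth_averagedMarginal`,
`Game.mul_welfare_le_of_smooth`).

Upper bound. In `nestedGame` each agent faces two equally large sets whose resources have all been
taken by every predecessor, so it is indifferent under any utility rule. Ties can be broken so that
the chosen sets are nested and cover about half of what disjoint choices would cover. For
`affineRule` the welfare is `c` times the coverage plus `1 - c` times the total number of uses, and
the latter is the same in both profiles; the ratio tends to `1 - c / 2`. -/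

namespace ResourceAllocation

open Finset

/-! ### Welfare rules of bounded curvature -/

section WelfareRule

variable {w : ℕ → ℝ} {c : ℝ}

theorem IsSubmodular.antitone_increments (h : IsSubmodular w) :
    Antitone fun n => w (n + 1) - w n :=
  antitone_nat_of_succ_le h.2

/-- The increments decrease to `(1 - c') * w 1` with `c' ≤ c`, so none lies below `(1 - c) * w 1`.
-/
theorem increment_ge_of_mem_curvatureClass (h : w ∈ curvatureClass c) (n : ℕ) :
    (1 - c) * w 1 ≤ w (n + 1) - w n := by
  obtain ⟨c', hc', hw, hs, -, ht⟩ := h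
  have h1 : 0 < w 1 := hw.2 1 le_rfl
  have hm : Monotone fun n : ℕ => 1 - (w (n + 1) - w n) / w 1 := fun a b hab =>
    sub_le_sub_left (div_le_div_of_nonneg_right (hs.antitone_increments hab) h1.le) 1
  have h2 := hm.ge_of_tendsto ht n
  have h3 : 1 - c ≤ (w (n + 1) - w n) / w 1 := by linarith
  exact (le_div_iff₀ h1).1 h3

theorem mul_sub_le_sub_of_increment_ge {d : ℝ} (hd : ∀ n, d ≤ w (n + 1) - w n) {y x : ℕ}
    (hyx : y ≤ x) : ((x : ℝ) - y) * d ≤ w x - w y := by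
  induction x, hyx using Nat.le_induction with
  | base => simp
  | succ k _ ih =>
    push_cast
    linarith [hd k]

theorem IsSubmodular.sub_le_mul_increment (h : IsSubmodular w) {x y : ℕ} (hxy : x ≤ y) :
    w y - w x ≤ ((y : ℝ) - x) * (w (x + 1) - w x) := by
  induction y, hxy using Nat.le_induction with
  | base => simp
  | succ k hk ih =>
    have := h.antitone_increments hk
    dsimp only at this
    push_cast
    linarith

theorem IsSubmodular.add_mul_le_add_mul_increment (h : IsSubmodular w) {d : ℝ}
    (hd : ∀ n, d ≤ w (n + 1) - w n) (x y : ℕ) :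
    w y + x * d ≤ w x + y * (w (x + 1) - w x) := by
  rcases le_total y x with hyx | hxy
  · have h1 := mul_sub_le_sub_of_increment_ge hd hyx
    have h2 := mul_le_mul_of_nonneg_left (hd x) (Nat.cast_nonneg (α := ℝ) y)
    linarith
  · have h1 := h.sub_le_mul_increment hxy
    have h2 := mul_le_mul_of_nonneg_left (hd x) (Nat.cast_nonneg (α := ℝ) x)
    linarith

/-- The average of the marginal welfare and its smallest possible limit. -/
noncomputable def averagedMarginal (c : ℝ) (w : ℕ → ℝ) (j : ℕ) : ℝ :=
  (w j - w (j - 1) + (1 - c) * w 1) / 2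

theorem averagedMarginal_succ_nonneg (hc : c ≤ 1) (h : w ∈ curvatureClass c) (j : ℕ) :
    0 ≤ averagedMarginal c w (j + 1) := by
  have h1 := increment_ge_of_mem_curvatureClass h j
  obtain ⟨c', -, hw, -⟩ := h
  have h2 : 0 ≤ (1 - c) * w 1 := mul_nonneg (by linarith) (hw.2 1 le_rfl).le
  simp only [averagedMarginal, Nat.add_sub_cancel]
  linarith

theorem averagedMarginal_succ_antitone (h : IsSubmodular w) :
    Antitone fun j => averagedMarginal c w (j + 1) := fun a b hab => by
  have := h.antitone_increments hab
  simp only [averagedMarginal, Nat.add_sub_cancel] at this ⊢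
  linarith

theorem sum_averagedMarginal (h0 : w 0 = 0) (x : ℕ) :
    ∑ j ∈ range x, averagedMarginal c w (j + 1) = (w x + x * ((1 - c) * w 1)) / 2 := by
  induction x with
  | zero => simp [h0]
  | succ k ih =>
    rw [sum_range_succ, ih]
    simp only [averagedMarginal, Nat.add_sub_cancel]
    push_cast
    ring

/-- Doubled, the claim is the sum of `add_mul_le_add_mul_increment` with `d = (1 - c) * w 1` and of
`(1 - c) * w y ≤ y * d`, which follows from `w y ≤ y * w 1`. -/
theorem smooth_averagedMarginal (hc : c ≤ 1) (h : w ∈ curvatureClass c) (x y : ℕ) :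
    (1 - c / 2) * w y + ∑ j ∈ range x, averagedMarginal c w (j + 1) ≤
      w x + y * averagedMarginal c w (x + 1) := by
  have hd := increment_ge_of_mem_curvatureClass h
  obtain ⟨c', -, hw, hs, -⟩ := h
  have h1 := hs.add_mul_le_add_mul_increment hd x y
  have h2 := hs.sub_le_mul_increment (Nat.zero_le y)
  have h3 : (1 - c) * w y ≤ (1 - c) * (y * w 1) :=
    mul_le_mul_of_nonneg_left (by simpa [hw.1] using h2) (by linarith)
  rw [sum_averagedMarginal hw.1]
  simp only [averagedMarginal, Nat.add_sub_cancel]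
  linarith

end WelfareRule

/-- The number of predecessors of an element within `S` is its rank, and the ranks run once through
`range S.card`. -/
theorem sum_card_filter_lt {ι M : Type*} [LinearOrder ι] [AddCommMonoid M] (S : Finset ι)
    (g : ℕ → M) : ∑ i ∈ S, g (S.filter (· < i)).card = ∑ j ∈ range S.card, g j := by
  induction S using Finset.induction_on_max with
  | empty => simp
  | insert a s ha ih =>
    have has : a ∉ s := fun h => lt_irrefl _ (ha a h)
    have h1 : (insert a s).filter (· < a) = s := by
      ext x
      simp only [mem_filter, mem_insert]
      exact ⟨fun h => h.1.resolve_left h.2.ne, fun h => ⟨Or.inr h, ha x h⟩⟩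
    have h2 : ∀ i ∈ s, (insert a s).filter (· < i) = s.filter (· < i) := fun i hi => by
      rw [filter_insert, if_neg (ha i hi).not_gt]
    rw [sum_insert has, card_insert_of_notMem has, sum_range_succ, h1, add_comm, ← ih]
    congr 1
    exact sum_congr rfl fun i hi => by rw [h2 i hi]

namespace Game

variable (G : Game)

/-! ### Welfare -/

theorem load_pos_iff (a : G.Profile) (r : Fin G.m) : 0 < G.load a r ↔ r ∈ univ.biUnion a := by
  simp [load, card_pos, Finset.Nonempty]

theorem welfare_eq_sum (h0 : ∀ r, G.w r 0 = 0) (a : G.Profile) :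
    G.welfare a = ∑ r, G.w r (G.load a r) := by
  refine sum_subset (subset_univ _) fun r _ hr => ?_
  rw [← load_pos_iff, Nat.pos_iff_ne_zero, not_not] at hr
  rw [hr, h0]

theorem sum_load (a : G.Profile) : ∑ r, G.load a r = ∑ i, (a i).card := by
  simp only [load, card_eq_sum_ones, sum_filter]
  rw [sum_comm]
  simp

theorem finite_jointActions : G.jointActions.Finite := by
  refine (Fintype.piFinset G.act).finite_toSet.subset fun a ha => ?_
  simpa [jointActions] using ha

/-! ### Best response walks -/

theorem bestResponses_nonempty (a : G.Profile) (i : Fin G.n) : (G.bestResponses a i).Nonempty := by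
  obtain ⟨b, hb, h⟩ := exists_max_image (G.act i) (fun b => G.utility i (Function.update a i b))
    ⟨∅, G.null_mem i⟩
  exact ⟨b, hb, h⟩

/-- A best response walk, with arbitrary choices of the best responses. -/
noncomputable def someWalk : ℕ → G.Profile
  | 0 => fun _ => ∅
  | τ + 1 => if h : 0 < G.n then
      Function.update (someWalk τ) ⟨τ % G.n, Nat.mod_lt _ h⟩
        (G.bestResponses_nonempty (someWalk τ) ⟨τ % G.n, Nat.mod_lt _ h⟩).some
    else someWalk τ

/-- Needed because the real infimum in `efficiency` is `0` by default on an empty set. -/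
theorem solutions_nonempty (k : ℕ) : (G.solutions k).Nonempty := by
  refine ⟨_, G.someWalk, ⟨rfl, fun τ hτ => ?_⟩, rfl⟩
  have h : 0 < G.n := Nat.pos_of_ne_zero fun h => by simp [h] at hτ
  refine ⟨⟨τ % G.n, Nat.mod_lt _ h⟩, rfl, ?_, fun j hj => ?_⟩
  · rw [someWalk, dif_pos h, Function.update_self]
    exact Set.Nonempty.some_mem _
  · rw [someWalk, dif_pos h, Function.update_of_ne hj]

variable {G}

/-- The joint action in which the agents before `k` follow `b` and the others have not moved. -/
def truncate (b : G.Profile) (k : ℕ) : G.Profile := fun i => if (i : ℕ) < k then b i else ∅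

theorem load_truncate_update (b : G.Profile) (i : Fin G.n) (e : Finset (Fin G.m)) {r : Fin G.m}
    (hr : r ∈ e) : G.load (Function.update (truncate b i) i e) r =
      (univ.filter fun j => r ∈ b j ∧ j < i).card + 1 := by
  have h : (univ.filter fun j => r ∈ Function.update (truncate b i) i e j) =
      insert i (univ.filter fun j => r ∈ b j ∧ j < i) := by
    ext j
    rcases eq_or_ne j i with rfl | hj
    · simp [hr]
    · by_cases hlt : j < i <;> simp [hj, truncate, hlt]
  rw [load, h, card_insert_of_notMem (by simp)]

theorem utility_truncate_update (b : G.Profile) (i : Fin G.n) (e : Finset (Fin G.m)) :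
    G.utility i (Function.update (truncate b i) i e) =
      ∑ r ∈ e, (G.f r ((univ.filter fun j => r ∈ b j ∧ j < i).card + 1) : ℝ) := by
  rw [utility, Function.update_self]
  exact sum_congr rfl fun r hr => by rw [load_truncate_update b i e hr]

/-- The outcomes of a one-round walk: every agent best responds to its predecessors. -/
theorem mem_solutions_one_iff (b : G.Profile) :
    b ∈ G.solutions 1 ↔ ∀ i : Fin G.n, b i ∈ G.bestResponses (truncate b i) i := by
  constructor
  · rintro ⟨a, ⟨h0, ha⟩, rfl⟩
    rw [one_mul] at ha ⊢
    have hstep : ∀ i : Fin G.n, a (i + 1) i ∈ G.bestResponses (a i) i ∧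
        ∀ j, j ≠ i → a (i + 1) j = a i j := fun i => by
      obtain ⟨i', hi', h⟩ := ha i i.2
      rw [Nat.mod_eq_of_lt i.2] at hi'
      obtain rfl := Fin.ext hi'
      exact h
    -- Agent `i` moves only at step `i`: its action is final afterwards and empty before, so `a i`
    -- is a truncation of the end state.
    have hkeep : ∀ (i : Fin G.n) (τ : ℕ), (i : ℕ) + 1 ≤ τ → τ ≤ G.n →
        a τ i = a (i + 1) i := by
      intro i τ h
      induction τ, h using Nat.le_induction with
      | base => exact fun _ => rfl
      | succ k hk ih =>
        intro hn
        rw [← ih (by omega)]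
        exact (hstep ⟨k, hn⟩).2 i fun h => by
          have := congrArg Fin.val h
          dsimp only at this
          omega
    have hnull : ∀ (i : Fin G.n) (τ : ℕ), τ ≤ i → a τ i = ∅ := by
      intro i τ
      induction τ with
      | zero => simp [h0]
      | succ k ih =>
        intro hk
        rw [← ih (by omega)]
        exact (hstep ⟨k, by omega⟩).2 i fun h => by
          have := congrArg Fin.val h
          dsimp only at this
          omega
    intro i
    have htr : truncate (a G.n) i = a i := by
      funext j
      by_cases hj : (j : ℕ) < i
      · rw [truncate, if_pos hj, hkeep j G.n j.2 le_rfl, hkeep j i hj i.2.le]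
      · rw [truncate, if_neg hj, hnull j i (not_lt.1 hj)]
    rw [htr, hkeep i G.n i.2 le_rfl]
    exact (hstep i).1
  · intro h
    -- The truncations of `b` themselves form the walk.
    refine ⟨truncate b, ⟨by funext i; simp [truncate], fun τ hτ => ?_⟩, by
      funext i; simp [truncate]⟩
    rw [one_mul] at hτ
    refine ⟨⟨τ, hτ⟩, (Nat.mod_eq_of_lt hτ).symm, ?_, fun j hj => ?_⟩
    · simpa [truncate] using h ⟨τ, hτ⟩
    · have : (j : ℕ) ≠ τ := fun h => hj (Fin.ext h)
      have h2 : (j : ℕ) < τ + 1 ↔ (j : ℕ) < τ := by omega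
      simp [truncate, h2]

theorem solutions_one_subset : G.solutions 1 ⊆ G.jointActions := fun b hb i =>
  ((mem_solutions_one_iff b).1 hb i).1

/-! ### Smoothness and one-round outcomes -/

/-- The users of `r`, in order of moving, are paid at loads `1, 2, ...` up to the final load. -/
theorem sum_utility_truncate (b : G.Profile) :
    ∑ i, ∑ r ∈ b i, (G.f r ((univ.filter fun j => r ∈ b j ∧ j < i).card + 1) : ℝ) =
      ∑ r, ∑ j ∈ range (G.load b r), (G.f r (j + 1) : ℝ) := by
  have h : ∀ r : Fin G.m, ∑ j ∈ range (G.load b r), (G.f r (j + 1) : ℝ) =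
      ∑ i ∈ univ.filter (fun i => r ∈ b i),
        (G.f r ((univ.filter fun j => r ∈ b j ∧ j < i).card + 1) : ℝ) := fun r => by
    rw [load, ← sum_card_filter_lt]
    simp only [filter_filter]
  simp only [h, sum_filter]
  rw [sum_comm]
  exact sum_congr rfl fun i _ => by simp

/-- The predecessors of an agent that use `r` are among all users of `r` in `b`, so monotonicity of
`f` bounds the deviation payoff from below. -/
theorem sum_load_mul_le (hf : ∀ r, Antitone fun j => G.f r (j + 1)) (b o : G.Profile) :
    ∑ r, (G.load o r : ℝ) * G.f r (G.load b r + 1) ≤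
      ∑ i, ∑ r ∈ o i, (G.f r ((univ.filter fun j => r ∈ b j ∧ j < i).card + 1) : ℝ) := by
  have h : ∀ r : Fin G.m, (G.load o r : ℝ) * G.f r (G.load b r + 1) =
      ∑ i, if r ∈ o i then (G.f r (G.load b r + 1) : ℝ) else 0 := fun r => by
    rw [← sum_filter, sum_const, nsmul_eq_mul, load]
  simp only [h]
  rw [sum_comm]
  refine sum_le_sum fun i _ => ?_
  rw [← sum_filter, filter_mem_eq_inter, univ_inter]
  refine sum_le_sum fun r _ => ?_
  refine NNReal.coe_le_coe.2 (hf r (card_le_card fun j => ?_))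
  simp only [mem_filter, mem_univ, true_and]
  exact fun h => h.1

/-- A smoothness inequality for every resource bounds the welfare of one-round outcomes. -/
theorem mul_welfare_le_of_smooth {α : ℝ} (h0 : ∀ r, G.w r 0 = 0)
    (hf : ∀ r, Antitone fun j => G.f r (j + 1))
    (hs : ∀ r (x y : ℕ), α * G.w r y + ∑ j ∈ range x, (G.f r (j + 1) : ℝ) ≤
      G.w r x + y * G.f r (x + 1))
    {b o : G.Profile} (hb : b ∈ G.solutions 1) (ho : o ∈ G.jointActions) :
    α * G.welfare o ≤ G.welfare b := by
  rw [mem_solutions_one_iff] at hb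
  -- Each agent could have played `o i` against its predecessors' actions in `b`.
  have h1 : ∑ i, ∑ r ∈ o i, (G.f r ((univ.filter fun j => r ∈ b j ∧ j < i).card + 1) : ℝ) ≤
      ∑ i, ∑ r ∈ b i, (G.f r ((univ.filter fun j => r ∈ b j ∧ j < i).card + 1) : ℝ) :=
    sum_le_sum fun i _ => by
      rw [← utility_truncate_update, ← utility_truncate_update]
      exact (hb i).2 _ (ho i)
  rw [sum_utility_truncate] at h1
  have h2 := sum_load_mul_le hf b o
  have h3 := sum_le_sum fun (r : Fin G.m) (_ : r ∈ univ) => hs r (G.load b r) (G.load o r)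
  rw [sum_add_distrib, sum_add_distrib, ← mul_sum] at h3
  rw [welfare_eq_sum G h0, welfare_eq_sum G h0]
  linarith

theorem le_efficiency_one {α : ℝ} (hpos : ∃ a ∈ G.jointActions, 0 < G.welfare a)
    (h : ∀ b ∈ G.solutions 1, ∀ o ∈ G.jointActions, α * G.welfare o ≤ G.welfare b) :
    α ≤ G.efficiency 1 := by
  have hbdd := (G.finite_jointActions.image G.welfare).bddAbove
  obtain ⟨a, ha, hapos⟩ := hpos
  have hsup : 0 < sSup (G.welfare '' G.jointActions) :=
    hapos.trans_le (le_csSup hbdd ⟨a, ha, rfl⟩)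
  obtain ⟨o, ho, hmax⟩ := (Set.Nonempty.image G.welfare ⟨a, ha⟩).csSup_mem
    (G.finite_jointActions.image G.welfare)
  rw [efficiency, le_div_iff₀ hsup, ← hmax]
  refine le_csInf ((G.solutions_nonempty 1).image _) ?_
  rintro _ ⟨b, hb, rfl⟩
  exact h b hb o ho

theorem efficiency_one_le {b o : G.Profile} (hb : b ∈ G.solutions 1) (ho : o ∈ G.jointActions)
    (hb0 : 0 ≤ G.welfare b) (hpos : 0 < G.welfare o) :
    G.efficiency 1 ≤ G.welfare b / G.welfare o := by
  have hfin := G.finite_jointActions.image G.welfare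
  have hbdd : BddBelow (G.welfare '' G.solutions 1) :=
    (hfin.subset (Set.image_mono solutions_one_subset)).bddBelow
  exact div_le_div₀ hb0 (csInf_le hbdd ⟨b, hb, rfl⟩) hpos (le_csSup hfin.bddAbove ⟨o, ho, rfl⟩)

end Game

/-! ### The lower bound -/

theorem le_optimalEfficiency_one {c : ℝ} (hc : c ≤ 1) :
    ((1 - c / 2 : ℝ) : EReal) ≤ optimalEfficiency (curvatureClass c) 1 := by
  -- Only `j ≥ 1` matters; there the averaged marginal is nonnegative and `toNNReal` loses nothing.
  refine le_iSup_of_le (fun w j => (averagedMarginal c w j).toNNReal) ?_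
  refine le_iInf₂ fun G hG => EReal.coe_le_coe_iff.2 ?_
  obtain ⟨hr, hpos⟩ := hG
  have hf : ∀ r j, (G.f r (j + 1) : ℝ) = averagedMarginal c (G.w r) (j + 1) := fun r j => by
    obtain ⟨h, hfr⟩ := hr r
    rw [hfr]
    exact Real.coe_toNNReal _ (averagedMarginal_succ_nonneg hc h j)
  refine Game.le_efficiency_one hpos fun b hb o ho =>
    Game.mul_welfare_le_of_smooth (fun r => ?_) (fun r => ?_) (fun r x y => ?_) hb ho
  · obtain ⟨⟨c', -, hw, -⟩, -⟩ := hr r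
    exact hw.1
  · intro i j hij
    obtain ⟨⟨c', -, -, hs, -⟩, -⟩ := hr r
    rw [← NNReal.coe_le_coe, hf, hf]
    exact averagedMarginal_succ_antitone hs hij
  · simp only [hf]
    exact smooth_averagedMarginal hc (hr r).1 x y

/-! ### Games with low efficiency for every utility design -/

/-- The welfare rule of curvature `c` that is affine on the positive numbers. -/
noncomputable def affineRule (c : ℝ) (j : ℕ) : ℝ := c * (if j = 0 then 0 else 1) + (1 - c) * j

theorem affineRule_mem_curvatureClass {c : ℝ} (hc : c ∈ Set.Icc (0 : ℝ) 1) :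
    affineRule c ∈ curvatureClass c := by
  obtain ⟨hc0, hc1⟩ := hc
  refine ⟨c, le_rfl, ⟨by simp [affineRule], fun j hj => ?_⟩, ⟨fun j => ?_, fun j => ?_⟩,
    ⟨hc0, hc1⟩, ?_⟩
  · have h1 : (1 : ℝ) ≤ j := by exact_mod_cast hj
    have h2 : j ≠ 0 := by omega
    simp only [affineRule, h2, if_false]
    nlinarith
  · rcases j with _ | j
    · simp [affineRule]
    · simp only [affineRule, Nat.succ_ne_zero, if_false]
      push_cast
      nlinarith
  · rcases j with _ | j
    · simp only [affineRule]
      norm_num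
      linarith
    · simp only [affineRule, Nat.succ_ne_zero, if_false]
      push_cast
      linarith
  · refine tendsto_const_nhds.congr' ?_
    filter_upwards [Filter.eventually_ge_atTop 1] with n hn
    have h2 : n ≠ 0 := by omega
    simp only [affineRule, h2, Nat.succ_ne_zero, one_ne_zero, if_false]
    push_cast
    ring

/-- Splits welfare into coverage and total use, so that profiles with equal total use differ only by
coverage. -/
theorem Game.welfare_of_affineRule (G : Game) {c : ℝ} (hw : ∀ r, G.w r = affineRule c)
    (a : G.Profile) :
    G.welfare a = c * (univ.biUnion a).card + (1 - c) * ∑ i, ((a i).card : ℝ) := by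
  have h : ∀ r, (if G.load a r = 0 then (0 : ℝ) else 1) =
      if r ∈ univ.biUnion a then 1 else 0 := fun r => by
    simp only [← G.load_pos_iff a r, Nat.pos_iff_ne_zero, ite_not]
  have h2 : ∑ r, (G.load a r : ℝ) = ∑ i, ((a i).card : ℝ) := by exact_mod_cast G.sum_load a
  rw [G.welfare_eq_sum (fun r => by simp [hw, affineRule])]
  simp only [hw, affineRule, h]
  rw [sum_add_distrib, ← mul_sum, ← mul_sum, h2, sum_ite_mem, univ_inter, sum_const, nsmul_one]

/-- The resources `r < 2 ^ (k - 1 - i)`. -/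
def initialSegment (k : ℕ) (i : Fin k) : Finset (Fin (2 ^ k)) :=
  univ.filter fun r => (r : ℕ) < 2 ^ (k - 1 - i)

/-- The resources `r` with `2 ^ (k - 1 - i) ≤ r < 2 ^ (k - i)`. -/
def dyadicBlock (k : ℕ) (i : Fin k) : Finset (Fin (2 ^ k)) :=
  univ.filter fun r => 2 ^ (k - 1 - i) ≤ (r : ℕ) ∧ (r : ℕ) < 2 ^ (k - i)

/-- Each agent chooses between two disjoint sets of equally many resources, all of which its
predecessors may have selected already. -/
abbrev nestedGame (w : ℕ → ℝ) (f : ℕ → ℝ≥0) (k : ℕ) : Game where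
  n := k
  m := 2 ^ k
  act i := {∅, initialSegment k i, dyadicBlock k i}
  null_mem i := by simp
  w _ := w
  f _ := f

theorem card_fin_filter_Ico {a b N : ℕ} (h : b ≤ N) :
    (univ.filter fun r : Fin N => a ≤ (r : ℕ) ∧ (r : ℕ) < b).card = b - a := by
  rw [← Nat.card_Ico, ← card_map Fin.valEmbedding]
  congr 1
  ext x
  simp only [mem_map, mem_filter, mem_univ, true_and, Fin.valEmbedding_apply, mem_Ico]
  exact ⟨by rintro ⟨r, hr, rfl⟩; exact hr, fun hx => ⟨⟨x, by omega⟩, hx, rfl⟩⟩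

theorem card_initialSegment (k : ℕ) (i : Fin k) :
    (initialSegment k i).card = 2 ^ (k - 1 - i) := by
  simpa [initialSegment] using card_fin_filter_Ico (a := 0)
    (Nat.pow_le_pow_right two_pos (by omega : k - 1 - i ≤ k))

theorem card_dyadicBlock (k : ℕ) (i : Fin k) : (dyadicBlock k i).card = 2 ^ (k - 1 - i) := by
  rw [dyadicBlock, card_fin_filter_Ico (Nat.pow_le_pow_right two_pos (by omega : k - i ≤ k)),
    show k - (i : ℕ) = k - 1 - i + 1 by omega, pow_succ]
  omega

theorem sum_two_pow_sub (k : ℕ) : ∑ i : Fin k, (2 : ℝ) ^ (k - 1 - (i : ℕ)) = 2 ^ k - 1 := by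
  rw [Fin.sum_univ_eq_sum_range (fun i => (2 : ℝ) ^ (k - 1 - i)),
    sum_range_reflect (fun i => (2 : ℝ) ^ i), geom_sum_eq (by norm_num)]
  norm_num

theorem card_biUnion_initialSegment_le (k : ℕ) :
    (univ.biUnion (initialSegment k)).card ≤ 2 ^ (k - 1) := by
  rw [← Nat.sub_zero (2 ^ (k - 1)),
    ← card_fin_filter_Ico (Nat.pow_le_pow_right two_pos (Nat.sub_le k 1))]
  refine card_le_card fun r hr => ?_
  simp only [initialSegment, mem_biUnion, mem_filter, mem_univ, true_and] at hr ⊢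
  obtain ⟨i, hi⟩ := hr
  exact ⟨Nat.zero_le _, hi.trans_le (Nat.pow_le_pow_right two_pos (Nat.sub_le _ _))⟩

/-- The blocks tile all resources except `0`. -/
theorem le_card_biUnion_dyadicBlock (k : ℕ) :
    2 ^ k - 1 ≤ (univ.biUnion (dyadicBlock k)).card := by
  rw [← card_fin_filter_Ico (le_refl (2 ^ k))]
  refine card_le_card fun r hr => ?_
  simp only [dyadicBlock, mem_biUnion, mem_filter, mem_univ, true_and] at hr ⊢
  have hr0 : (r : ℕ) ≠ 0 := by omega
  have hlog : Nat.log 2 r < k := Nat.log_lt_of_lt_pow hr0 hr.2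
  -- Block `i` consists of the `r` with `Nat.log 2 r = k - 1 - i`.
  refine ⟨⟨k - 1 - Nat.log 2 r, by omega⟩, ?_⟩
  rw [show k - 1 - (k - 1 - Nat.log 2 (r : ℕ)) = Nat.log 2 r by omega,
    show k - (k - 1 - Nat.log 2 (r : ℕ)) = Nat.log 2 r + 1 by omega]
  exact ⟨Nat.pow_log_le_self 2 hr0, Nat.lt_pow_succ_log_self one_lt_two _⟩

/-- Both nonempty actions of agent `i` lie in `r < 2 ^ (k - i)`, which is contained in the segment
of every predecessor. Each resource then pays `f (i + 1)`, and equal cardinalities give a tie. -/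
theorem initialSegment_mem_solutions (w : ℕ → ℝ) (f : ℕ → ℝ≥0) (k : ℕ) :
    (initialSegment k : (nestedGame w f k).Profile) ∈ (nestedGame w f k).solutions 1 := by
  refine (Game.mem_solutions_one_iff (G := nestedGame w f k) _).2 fun (i : Fin k) => ?_
  have hu : ∀ e : Finset (Fin (2 ^ k)), (∀ r ∈ e, (r : ℕ) < 2 ^ (k - i)) →
      (nestedGame w f k).utility i (Function.update
        (Game.truncate (G := nestedGame w f k) (initialSegment k) i) i e) =
        e.card * (f (i + 1) : ℝ) := fun e he => by
    rw [Game.utility_truncate_update (G := nestedGame w f k), ← nsmul_eq_mul]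
    refine sum_eq_card_nsmul fun (r : Fin (2 ^ k)) hr => ?_
    have h1 : (univ.filter fun j : Fin k => r ∈ initialSegment k j ∧ j < i) = Iio i := by
      ext j
      simp only [initialSegment, mem_filter, mem_univ, true_and, mem_Iio, and_iff_right_iff_imp]
      intro hj
      have hj' : (j : ℕ) < i := hj
      exact (he r hr).trans_le (Nat.pow_le_pow_right two_pos (by omega))
    have h2 : (univ.filter fun j : Fin k => r ∈ initialSegment k j ∧ j < i).card = i := by
      rw [h1, Fin.card_Iio]
    exact congrArg (fun n => ((f (n + 1) : ℝ≥0) : ℝ)) h2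
  have ha := hu (initialSegment k i) fun r hr => by
    simp only [initialSegment, mem_filter, mem_univ, true_and] at hr
    exact hr.trans_le (Nat.pow_le_pow_right two_pos (by omega))
  have ho := hu (dyadicBlock k i) fun r hr => by
    simp only [dyadicBlock, mem_filter, mem_univ, true_and] at hr
    exact hr.2
  have h0 := hu ∅ (by simp)
  refine ⟨by simp [nestedGame], fun e he => ?_⟩
  rw [ha, card_initialSegment]
  have he' : e = ∅ ∨ e = initialSegment k i ∨ e = dyadicBlock k i := by
    simpa [nestedGame] using he
  rcases he' with rfl | rfl | rfl
  · rw [h0, card_empty, Nat.cast_zero, zero_mul]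
    positivity
  · rw [ha, card_initialSegment]
  · rw [ho, card_dyadicBlock]

theorem welfare_initialSegment_le {c : ℝ} (hc : 0 ≤ c) (f : ℕ → ℝ≥0) (k : ℕ) :
    (nestedGame (affineRule c) f (k + 1)).welfare (initialSegment (k + 1)) ≤
      c * 2 ^ k + (1 - c) * (2 ^ (k + 1) - 1) := by
  rw [Game.welfare_of_affineRule (nestedGame (affineRule c) f (k + 1)) (fun _ => rfl)]
  have h1 : ((univ.biUnion (initialSegment (k + 1))).card : ℝ) ≤ 2 ^ k := by
    exact_mod_cast card_biUnion_initialSegment_le (k + 1)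
  have h2 : ∑ i : Fin (k + 1), ((initialSegment (k + 1) i).card : ℝ) = 2 ^ (k + 1) - 1 := by
    rw [← sum_two_pow_sub]
    exact sum_congr rfl fun i _ => by rw [card_initialSegment]; push_cast; rfl
  exact add_le_add (mul_le_mul_of_nonneg_left h1 hc) (congrArg ((1 - c) * ·) h2).le

theorem le_welfare_dyadicBlock {c : ℝ} (hc : 0 ≤ c) (f : ℕ → ℝ≥0) (k : ℕ) :
    2 ^ k - 1 ≤ (nestedGame (affineRule c) f k).welfare (dyadicBlock k) := by
  rw [Game.welfare_of_affineRule (nestedGame (affineRule c) f k) (fun _ => rfl)]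
  have h1 : (2 : ℝ) ^ k - 1 ≤ (univ.biUnion (dyadicBlock k)).card := by
    have := le_card_biUnion_dyadicBlock k
    rw [tsub_le_iff_right] at this
    rw [sub_le_iff_le_add]
    exact_mod_cast this
  have h2 : ∑ i : Fin k, ((dyadicBlock k i).card : ℝ) = 2 ^ k - 1 := by
    rw [← sum_two_pow_sub]
    exact sum_congr rfl fun i _ => by rw [card_dyadicBlock]; push_cast; rfl
  calc (2 : ℝ) ^ k - 1 = c * (2 ^ k - 1) + (1 - c) * (2 ^ k - 1) := by ring
    _ ≤ _ := add_le_add (mul_le_mul_of_nonneg_left h1 hc) (congrArg ((1 - c) * ·) h2).ge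

theorem dyadicBlock_mem_jointActions (w : ℕ → ℝ) (f : ℕ → ℝ≥0) (k : ℕ) :
    (dyadicBlock k : (nestedGame w f k).Profile) ∈ (nestedGame w f k).jointActions :=
  fun i => by simp [nestedGame]

theorem two_pow_succ_sub_one_pos (k : ℕ) : (0 : ℝ) < 2 ^ (k + 1) - 1 :=
  sub_pos.2 (one_lt_pow₀ one_lt_two k.succ_ne_zero)

/-- With `k + 1` agents the denominator `2 ^ (k + 1) - 1` is positive; the excess over `1 - c / 2`
arises because resource `0` is in no block. -/
theorem efficiency_nestedGame_le {c : ℝ} (hc : c ∈ Set.Icc (0 : ℝ) 1) (f : ℕ → ℝ≥0) (k : ℕ) :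
    (nestedGame (affineRule c) f (k + 1)).efficiency 1 ≤
      1 - c / 2 + c / 2 / (2 ^ (k + 1) - 1) := by
  have hpos := two_pow_succ_sub_one_pos k
  have ho := le_welfare_dyadicBlock hc.1 f (k + 1)
  have hb := welfare_initialSegment_le hc.1 f k
  have hb0 : 0 ≤ (nestedGame (affineRule c) f (k + 1)).welfare (initialSegment (k + 1)) := by
    rw [Game.welfare_of_affineRule (nestedGame (affineRule c) f (k + 1)) (fun _ => rfl)]
    have := hc.1
    have := sub_nonneg.2 hc.2
    positivity
  calc _ ≤ _ := Game.efficiency_one_le (initialSegment_mem_solutions _ f (k + 1))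
        (dyadicBlock_mem_jointActions _ f (k + 1)) hb0 (hpos.trans_le ho)
    _ ≤ (c * 2 ^ k + (1 - c) * (2 ^ (k + 1) - 1)) / (2 ^ (k + 1) - 1) :=
        div_le_div₀ (hb0.trans hb) hb hpos ho
    _ = _ := by
        field_simp
        ring

theorem optimalEfficiency_one_le {c : ℝ} (hc : c ∈ Set.Icc (0 : ℝ) 1) :
    optimalEfficiency (curvatureClass c) 1 ≤ ((1 - c / 2 : ℝ) : EReal) := by
  refine iSup_le fun F => ?_
  let w : curvatureClass c := ⟨affineRule c, affineRule_mem_curvatureClass hc⟩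
  have hlim : Filter.Tendsto (fun k : ℕ => 1 - c / 2 + c / 2 / ((2 : ℝ) ^ (k + 1) - 1))
      Filter.atTop (nhds (1 - c / 2)) := by
    have h1 : Filter.Tendsto (fun k : ℕ => (2 : ℝ) ^ (k + 1) - 1) Filter.atTop Filter.atTop :=
      Filter.tendsto_atTop_add_const_right _ (-1)
        ((tendsto_pow_atTop_atTop_of_one_lt one_lt_two).comp (Filter.tendsto_add_atTop_nat 1))
    simpa using (h1.const_div_atTop (c / 2)).const_add (1 - c / 2)
  -- For fixed `F`, the bound from each nested game passes to the limit of many agents.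
  refine ge_of_tendsto' ((continuous_coe_real_ereal.tendsto _).comp hlim) fun k => ?_
  have hmem : nestedGame (affineRule c) (F w) (k + 1) ∈ inducedGames (curvatureClass c) F :=
    ⟨fun _ => ⟨w.2, rfl⟩, _, dyadicBlock_mem_jointActions _ _ _,
      (two_pow_succ_sub_one_pos k).trans_le (le_welfare_dyadicBlock hc.1 _ _)⟩
  exact (iInf₂_le _ hmem).trans (EReal.coe_le_coe_iff.2 (efficiency_nestedGame_le hc _ k))

end ResourceAllocation

theorem theorem2 (c : ℝ) (hc : c ∈ Set.Icc (0 : ℝ) 1) :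
    ResourceAllocation.optimalEfficiency (ResourceAllocation.curvatureClass c) 1
        = ((1 - c / 2 : ℝ) : EReal) ∧
      (1 / 2 : ℝ) ≤ 1 - c / 2 :=
  ⟨le_antisymm (ResourceAllocation.optimalEfficiency_one_le hc)
    (ResourceAllocation.le_optimalEfficiency_one hc.2), by linarith [hc.2]⟩
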